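/- Let $p\ge 2$ be an integer. Let $\tilde G$ be the Vilenkin group of sequences $x=(x_j)_{j\in\mathbb Z}$ with $x_j\in\{0,\dots,p-1\}$ and $x_j=0$ for all sufficiently negative $j$, with coordinatewise addition $\oplus$ modulo $p$ (and subtraction $\ominus$). Give it the group topology in which the subgroups $U_l=\{x : x_j=0 \text{ for } j\le l\}$, $l\in\mathbb Z$, form a neighbourhood basis of $0$, and the Haar measure $\mu$ with $\mu(U_0)=1$. Its dual $\tilde G^*$ is a copy of the same group, with Haar measure $\mu^*$ normalized in the same way, via the pairing $\chi(x,\omega)=\exp\big(\frac{2\pi i}{p}\sum_{j\in\mathbb Z}x_j\omega_{1-j}\big)$. Let $H=\{x\in\tilde G : x_j=0 \text{ for } j>0\}$, and let $H^\perp=\{\omega\in\tilde G^* : \chi(x,\omega)=1 \text{ for all } x\in H\}$ be its annihilator. For $\phi\in L^2(\tilde G)$ let $\langle\phi\rangle=\overline{\operatorname{span}}\{\phi(\cdot\ominus h) : h\in H\}\subseteq L^2(\tilde G)$ be the principal shift-invariant space generated by $\phi$. Let $\hat\phi\in L^2(\tilde G^*)$ be the Fourier transform of $\phi$, that is, the $L^2$-limit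 as $n\to\infty$ of $\omega\mapsto\int_{U_{-n}}\phi(x)\overline{\chi(x,\omega)}\,d\mu(x)$. Put $$P_\phi(\omega)=\sum_{h\in H^\perp}|\hat\phi(\omega\oplus h)|^2\in[0,\infty],\qquad \mathbb E_\phi=\{\omega\in\tilde G^* : P_\phi(\omega)\ne 0\}.$$ If $\phi,\psi\in L^2(\tilde G)$ satisfy $\langle\phi\rangle=\langle\psi\rangle$, then $\mathbb E_\phi=\mathbb E_\psi$ up to a set of $\mu^*$-measure zero. -/

import Mathlib

open MeasureTheory Filter Topology
open scoped ENNReal Pointwise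

/-- The sequences `x : ℤ → ZMod p` that vanish for all sufficiently negative indices, as a subgroup
of all sequences under coordinatewise addition modulo `p`. -/
def vilenkinSequences (p : ℕ) : AddSubgroup (ℤ → ZMod p) where
  carrier := {x | ∃ k : ℤ, ∀ j < k, x j = 0}
  zero_mem' := ⟨0, fun _ _ => rfl⟩
  add_mem' := by
    rintro x y ⟨k, hk⟩ ⟨l, hl⟩
    refine ⟨min k l, fun j hj => ?_⟩
    simp [hk j (lt_of_lt_of_le hj (min_le_left _ _)), hl j (lt_of_lt_of_le hj (min_le_right _ _))]
  neg_mem' := by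
    rintro x ⟨k, hk⟩
    exact ⟨k, fun j hj => by simp [hk j hj]⟩

/-- The Vilenkin group of order `p`. The type is a synonym, so that it does not inherit the
product topology of `ℤ → ZMod p`. -/
def VilenkinGroup (p : ℕ) : Type := vilenkinSequences p

/-- The dual group, realised as the same group of sequences; it is paired with `VilenkinGroup p`
by `VilenkinGroup.chi`. -/
abbrev VilenkinDual (p : ℕ) : Type := VilenkinGroup p

namespace VilenkinGroup

variable {p : ℕ}

instance : AddCommGroup (VilenkinGroup p) :=
  inferInstanceAs (AddCommGroup (vilenkinSequences p))

instance : CoeFun (VilenkinGroup p) (fun _ => ℤ → ZMod p) := ⟨fun x => x.1⟩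

theorem add_apply (x y : VilenkinGroup p) (j : ℤ) : (x + y) j = x j + y j := rfl

theorem neg_apply (x : VilenkinGroup p) (j : ℤ) : (-x) j = -x j := rfl

theorem zero_apply (j : ℤ) : (0 : VilenkinGroup p) j = 0 := rfl

variable (p) in
/-- `U l` consists of the sequences with `x j = 0` for all `j ≤ l`. -/
def U (l : ℤ) : AddSubgroup (VilenkinGroup p) where
  carrier := {x | ∀ j ≤ l, x j = 0}
  zero_mem' := fun _ _ => rfl
  add_mem' := by
    intro x y hx hy j hj
    rw [add_apply, hx j hj, hy j hj, add_zero]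
  neg_mem' := by
    intro x hx j hj
    rw [neg_apply, hx j hj, neg_zero]

variable (p) in
/-- The sets `U l`, `l ∈ ℤ`, as a basis of neighbourhoods of zero. -/
@[reducible] def filterBasis : AddGroupFilterBasis (VilenkinGroup p) :=
  addGroupFilterBasisOfComm (Set.range fun l : ℤ => (U p l : Set (VilenkinGroup p)))
    (Set.range_nonempty _)
    (by
      rintro _ _ ⟨k, rfl⟩ ⟨l, rfl⟩
      exact ⟨_, ⟨max k l, rfl⟩, fun x hx =>
        ⟨fun j hj => hx j (hj.trans (le_max_left _ _)),
          fun j hj => hx j (hj.trans (le_max_right _ _))⟩⟩)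
    (by
      rintro _ ⟨l, rfl⟩
      exact (U p l).zero_mem)
    (by
      rintro _ ⟨l, rfl⟩
      refine ⟨_, ⟨l, rfl⟩, ?_⟩
      rintro _ ⟨x, hx, y, hy, rfl⟩
      exact (U p l).add_mem hx hy)
    (by
      rintro _ ⟨l, rfl⟩
      exact ⟨_, ⟨l, rfl⟩, fun x hx => (U p l).neg_mem hx⟩)

instance : TopologicalSpace (VilenkinGroup p) := (filterBasis p).topology

instance : IsTopologicalAddGroup (VilenkinGroup p) := (filterBasis p).isTopologicalAddGroup

instance : MeasurableSpace (VilenkinGroup p) := borel _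

instance : BorelSpace (VilenkinGroup p) := ⟨rfl⟩

theorem U_mem_nhds_zero (l : ℤ) : (U p l : Set (VilenkinGroup p)) ∈ 𝓝 (0 : VilenkinGroup p) :=
  (filterBasis p).mem_nhds_zero ⟨l, rfl⟩

/-- Setting the coordinates with index at most `l` to zero. -/
def truncate (l : ℤ) (y : ℤ → ZMod p) : VilenkinGroup p :=
  ⟨fun j => if j ≤ l then 0 else y j, l, fun _ hj => if_pos hj.le⟩

theorem truncate_apply (l : ℤ) (y : ℤ → ZMod p) (j : ℤ) :
    truncate l y j = if j ≤ l then 0 else y j := rfl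

theorem continuous_truncate (l : ℤ) : Continuous (truncate (p := p) l) := by
  rw [continuous_iff_continuousAt]
  intro y
  refine ((filterBasis p).nhds_hasBasis (truncate l y)).tendsto_right_iff.2 ?_
  rintro _ ⟨k, rfl⟩
  have h : ∀ᶠ z in 𝓝 y, ∀ j ∈ Finset.Ioc l k, z j = y j := by
    rw [Filter.eventually_all_finset]
    intro j _
    exact (continuous_apply j).continuousAt.eventually
      (show ({y j} : Set (ZMod p)) ∈ 𝓝 (y j) from by simp)
  filter_upwards [h] with z hz
  refine ⟨truncate l z - truncate l y, fun j hj => ?_, add_sub_cancel _ _⟩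
  rw [sub_eq_add_neg, add_apply, neg_apply, truncate_apply, truncate_apply]
  split_ifs with hjl
  · simp
  · simp [hz j (Finset.mem_Ioc.2 ⟨not_le.1 hjl, hj⟩)]

theorem isCompact_U [NeZero p] (l : ℤ) : IsCompact (U p l : Set (VilenkinGroup p)) := by
  have h : (U p l : Set (VilenkinGroup p)) = Set.range (truncate (p := p) l) := by
    ext x
    constructor
    · intro hx
      refine ⟨x, Subtype.ext (funext fun j => ?_)⟩
      rw [truncate_apply]
      split_ifs with hj
      · exact (hx j hj).symm
      · rfl
    · rintro ⟨y, rfl⟩ j hj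
      exact if_pos hj
  rw [h]
  exact isCompact_range (continuous_truncate l)

variable [NeZero p]

variable (p) in
/-- The compact open subgroup `U = U 0`. -/
def unitCompact : TopologicalSpace.PositiveCompacts (VilenkinGroup p) where
  carrier := U p 0
  isCompact' := isCompact_U 0
  interior_nonempty' := ⟨0, mem_interior_iff_mem_nhds.2 (U_mem_nhds_zero 0)⟩

variable (p) in
/-- The Haar measure normalised so that `U = U 0` has measure one. -/
noncomputable def haar : Measure (VilenkinGroup p) := Measure.addHaarMeasure (unitCompact p)

instance : (haar p).IsAddHaarMeasure :=
  inferInstanceAs (Measure.addHaarMeasure (unitCompact p)).IsAddHaarMeasure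

/-- The pairing `χ(x, ω) = exp ((2 π i / p) ∑ j, x j * ω (1 - j))`. The sum has finitely many nonzero
terms, and `ZMod.stdAddChar` sends the class of `a` modulo `p` to `exp (2 π i a / p)`. -/
noncomputable def chi (x : VilenkinGroup p) (ω : VilenkinDual p) : ℂ :=
  ZMod.stdAddChar (∑ᶠ j : ℤ, x j * ω (1 - j))

variable (p) in
/-- The discrete subgroup of the sequences with `x j = 0` for all `j > 0`. -/
def H : AddSubgroup (VilenkinGroup p) where
  carrier := {x | ∀ j > 0, x j = 0}
  zero_mem' := fun _ _ => rfl
  add_mem' := by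
    intro x y hx hy j hj
    rw [add_apply, hx j hj, hy j hj, add_zero]
  neg_mem' := by
    intro x hx j hj
    rw [neg_apply, hx j hj, neg_zero]

variable (p) in
/-- The annihilator of `H` in the dual group. -/
def Hperp : Set (VilenkinDual p) := {ω | ∀ x ∈ H p, chi x ω = 1}

variable (p) in
/-- The Hilbert space `L²` of the Vilenkin group. -/
abbrev L2 : Type := Lp ℂ 2 (haar p)

/-- The translation `(translate h f) x = f (x - h)` on `L²`. -/
noncomputable def translate (h : VilenkinGroup p) (f : L2 p) : L2 p :=
  Lp.compMeasurePreserving (fun x => x - h) (measurePreserving_sub_right (haar p) h) f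

/-- The principal shift-invariant space generated by `φ`: the closed linear span in `L²` of the
translates of `φ` by elements of `H`. -/
noncomputable def principalShiftInvariant (φ : L2 p) : Submodule ℂ (L2 p) :=
  (Submodule.span ℂ (Set.range fun h : H p => translate (h : VilenkinGroup p) φ)).topologicalClosure

/-- The Fourier integral of `f` over the compact open subgroup `U (-n)`. -/
noncomputable def truncatedFourier (f : L2 p) (n : ℕ) (ω : VilenkinDual p) : ℂ :=
  ∫ x in (U p (-(n : ℤ)) : Set (VilenkinGroup p)), f x * starRingEnd ℂ (chi x ω) ∂(haar p)

/-- `g` is the `L²` Fourier transform of `f`: the Fourier integrals of `f` over the exhausting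
sequence `U (-n)` converge to `g` in `L²` of the dual group. -/
def IsFourierTransform (f : L2 p) (g : Lp ℂ 2 (haar p : Measure (VilenkinDual p))) : Prop :=
  Tendsto (fun n : ℕ => eLpNorm (fun ω => truncatedFourier f n ω - g ω) 2 (haar p)) atTop (𝓝 0)

open Classical in
/-- The `L²` Fourier transform. By Plancherel's theorem the limit in `IsFourierTransform` always
exists, and it is unique as an element of `L²`, so that the value `0` is never used as a default. -/
noncomputable def fourier (f : L2 p) : Lp ℂ 2 (haar p : Measure (VilenkinDual p)) :=
  if h : ∃ g, IsFourierTransform f g then h.choose else 0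

/-- The periodization `∑ h ∈ H^⊥, |f̂(ω + h)|²`, with values in `[0, ∞]`. -/
noncomputable def periodization (f : L2 p) (ω : VilenkinDual p) : ℝ≥0∞ :=
  ∑' h : Hperp p, ‖fourier f (ω + (h : VilenkinDual p))‖ₑ ^ 2

/-- The set on which the periodization does not vanish. -/
def periodizationSupport (f : L2 p) : Set (VilenkinDual p) :=
  {ω | periodization f ω ≠ 0}

end VilenkinGroup

/-! It suffices that ψ ∈ ⟨φ⟩ forces 𝔼_ψ ⊆ 𝔼_φ almost everywhere; the theorem follows by symmetry.
Let N = {P_φ = 0}; there φ̂ = 0. Translation by h becomes multiplication by the conjugate of χ(h, ·)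
(`fourier_translate`), so f ↦ f̂ restricted to N is a bounded operator that kills every translate of
φ, hence their closed span, hence ψ (`fourier_ae_eq_zero_of_mem_principalShiftInvariant`). Since N
is H^⊥-invariant and H^⊥ is countable, for almost every ω ∈ N all the values ψ̂(ω + h) vanish, so
P_ψ(ω) = 0 (`periodizationSupport_ae_le`).

Most of the work is to show that the L² Fourier transform exists and is a contraction; the
Plancherel identity is not needed. The Fourier integral over U_{-n} is U_n-periodic, so its squared
norm is a sum over coset representatives. Bessel's inequality for the characters of U_{-n} bounds
this sum, and μ(U_n) μ(U_{-n}) = 1 makes the constant equal to 1 (`eLpNorm_truncatedFourier_le`). -/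

namespace VilenkinGroup

/-! ### Coordinates, the pairing and the annihilator -/

section Pairing

variable {p : ℕ}

@[ext]
theorem ext {x y : VilenkinGroup p} (h : ∀ j, x j = y j) : x = y :=
  Subtype.ext (funext h)

theorem sub_apply (x y : VilenkinGroup p) (j : ℤ) : (x - y) j = x j - y j := rfl

theorem U_anti {k l : ℤ} (h : k ≤ l) : U p l ≤ U p k :=
  fun _ hx j hj => hx j (hj.trans h)

theorem isOpen_U (l : ℤ) : IsOpen (U p l : Set (VilenkinGroup p)) :=
  (U p l).isOpen_of_mem_nhds (U_mem_nhds_zero l)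

theorem measurableSet_U (l : ℤ) : MeasurableSet (U p l : Set (VilenkinGroup p)) :=
  (isOpen_U l).measurableSet

theorem exists_mem_U (x : VilenkinGroup p) : ∃ l, x ∈ U p l := by
  obtain ⟨k, hk⟩ := x.2
  exact ⟨k - 1, fun j hj => hk j (by omega)⟩

theorem exists_mem_U_neg_nat (x : VilenkinGroup p) :
    ∃ n : ℕ, ∀ m ≥ n, x ∈ U p (-(m : ℤ)) := by
  obtain ⟨l, hl⟩ := exists_mem_U x
  exact ⟨(-l).toNat, fun m hm => U_anti (by omega) hl⟩

/-- A function that is periodic with respect to some `U l` is continuous. -/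
theorem continuous_of_periodic {Y : Type*} [TopologicalSpace Y] {f : VilenkinGroup p → Y} (l : ℤ)
    (hf : ∀ x, ∀ u ∈ U p l, f (x + u) = f x) : Continuous f := by
  rw [continuous_iff_continuousAt]
  intro x
  have h : f =ᶠ[𝓝 x] fun _ => f x := by
    have hU : ∀ᶠ y in 𝓝 x, y - x ∈ U p l := by
      have : Tendsto (fun y => y - x) (𝓝 x) (𝓝 0) := by
        have : Continuous fun y : VilenkinGroup p => y - x := by fun_prop
        simpa using this.tendsto x
      exact this.eventually (U_mem_nhds_zero l)
    filter_upwards [hU] with y hy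
    simpa using hf x _ hy
  exact h.continuousAt

/-- The sequence with the single entry `a` at the index `k`. -/
def single (k : ℤ) (a : ZMod p) : VilenkinGroup p :=
  ⟨Pi.single k a, k, fun _ hj => Pi.single_eq_of_ne hj.ne _⟩

theorem single_apply_self (k : ℤ) (a : ZMod p) : single k a k = a :=
  Pi.single_eq_same (M := fun _ : ℤ => ZMod p) k a

theorem single_apply_of_ne {k j : ℤ} (h : j ≠ k) (a : ZMod p) : single k a j = 0 :=
  Pi.single_eq_of_ne (M := fun _ : ℤ => ZMod p) h a

variable (p) in
/-- The sequences vanishing above the index `n`. -/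
def tail (n : ℤ) : AddSubgroup (VilenkinGroup p) where
  carrier := {x | ∀ j > n, x j = 0}
  zero_mem' := fun _ _ => rfl
  add_mem' := by
    intro x y hx hy j hj
    rw [add_apply, hx j hj, hy j hj, add_zero]
  neg_mem' := by
    intro x hx j hj
    rw [neg_apply, hx j hj, neg_zero]

theorem finite_support_of_mem_tail {n : ℤ} {x : VilenkinGroup p} (hx : x ∈ tail p n) :
    (Function.support (x : ℤ → ZMod p)).Finite := by
  obtain ⟨k, hk⟩ := x.2
  refine (Set.finite_Icc k n).subset fun j hj => ⟨?_, ?_⟩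
  · by_contra h
    exact hj (hk j (not_le.1 h))
  · by_contra h
    exact hj (hx j (not_le.1 h))

instance countable_tail [NeZero p] (n : ℤ) : Countable (tail p n) := by
  have : Countable (ZMod p) := Finite.to_countable
  refine Function.Injective.countable
    (f := fun x : tail p n => Finsupp.ofSupportFinite (x : VilenkinGroup p).1
      (finite_support_of_mem_tail x.2)) fun x y h => ?_
  refine Subtype.ext (ext fun j => ?_)
  exact DFunLike.congr_fun h j

theorem sub_truncate_mem_tail (l : ℤ) (x : VilenkinGroup p) : x - truncate l x ∈ tail p l := by
  intro j hj
  rw [sub_apply, truncate_apply, if_neg (not_le.2 hj), sub_self]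

theorem truncate_mem_U (l : ℤ) (y : ℤ → ZMod p) : truncate l y ∈ U p l :=
  fun _ hj => if_pos hj

theorem eq_of_sub_mem_U {l : ℤ} {s t : VilenkinGroup p} (hs : s ∈ tail p l) (ht : t ∈ tail p l)
    (h : s - t ∈ U p l) : s = t := by
  ext j
  rcases le_or_gt j l with hj | hj
  · exact sub_eq_zero.1 (h j hj)
  · rw [hs j hj, ht j hj]

theorem finite_support_pairing (x ω : VilenkinGroup p) :
    (Function.support fun j : ℤ => x j * ω (1 - j)).Finite := by
  obtain ⟨k, hk⟩ := x.2
  obtain ⟨l, hl⟩ := ω.2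
  refine (Set.finite_Icc k (1 - l)).subset fun j hj => ⟨?_, ?_⟩
  · by_contra h
    exact hj (by simp only [hk j (not_le.1 h), zero_mul])
  · by_contra h
    exact hj (by simp only [hl (1 - j) (by omega), mul_zero])

variable [NeZero p]

theorem chi_comm (x ω : VilenkinGroup p) : chi x ω = chi ω x := by
  unfold chi
  congr 1
  rw [← finsum_comp_equiv (Equiv.subLeft (1 : ℤ))]
  refine finsum_congr fun j => ?_
  simp [mul_comm]

theorem chi_add_left (x y ω : VilenkinGroup p) : chi (x + y) ω = chi x ω * chi y ω := by
  unfold chi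
  rw [← AddChar.map_add_eq_mul,
    ← finsum_add_distrib (finite_support_pairing x ω) (finite_support_pairing y ω)]
  congr 1
  refine finsum_congr fun j => ?_
  rw [add_apply, add_mul]

theorem chi_add_right (x ω τ : VilenkinGroup p) : chi x (ω + τ) = chi x ω * chi x τ := by
  rw [chi_comm, chi_add_left, chi_comm ω, chi_comm τ]

theorem chi_neg_right (x ω : VilenkinGroup p) : chi x (-ω) = starRingEnd ℂ (chi x ω) := by
  unfold chi
  rw [← AddChar.map_neg_eq_conj, ← finsum_neg_distrib]
  congr 1
  refine finsum_congr fun j => ?_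
  rw [neg_apply, mul_neg]

theorem norm_chi (x ω : VilenkinGroup p) : ‖chi x ω‖ = 1 :=
  AddChar.norm_apply _ _

theorem chi_eq_one {l : ℤ} {x ω : VilenkinGroup p} (hx : x ∈ U p l) (hω : ω ∈ U p (-l)) :
    chi x ω = 1 := by
  unfold chi
  rw [finsum_eq_zero_of_forall_eq_zero, AddChar.map_zero_eq_one]
  intro j
  rcases le_or_gt j l with hj | hj
  · rw [hx j hj, zero_mul]
  · rw [hω (1 - j) (by omega), mul_zero]

theorem chi_single (k : ℤ) (ω : VilenkinGroup p) :
    chi (single k 1) ω = ZMod.stdAddChar (ω (1 - k)) := by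
  unfold chi
  rw [finsum_eq_single _ k, single_apply_self, one_mul]
  intro j hj
  rw [single_apply_of_ne hj, zero_mul]

theorem chi_single_eq_one_iff {k : ℤ} {ω : VilenkinGroup p} :
    chi (single k 1) ω = 1 ↔ ω (1 - k) = 0 := by
  rw [chi_single, ← AddChar.map_zero_eq_one (ZMod.stdAddChar (N := p)),
    ZMod.injective_stdAddChar.eq_iff]

theorem continuous_chi_left (ω : VilenkinGroup p) : Continuous fun x => chi x ω := by
  obtain ⟨l, hl⟩ := exists_mem_U ω
  refine continuous_of_periodic (-l) fun x u hu => ?_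
  rw [chi_add_left, chi_eq_one hu (by rwa [neg_neg]), mul_one]

theorem continuous_chi_right (x : VilenkinGroup p) : Continuous fun ω => chi x ω := by
  simpa only [chi_comm x] using continuous_chi_left x

/-- Testing against one-entry elements of H isolates each coordinate of positive index. This
inclusion is enough to make H^⊥ countable. -/
theorem Hperp_subset_tail : Hperp p ⊆ tail p 0 := by
  intro ω hω j hj
  have h := chi_single_eq_one_iff.1 (hω (single (1 - j) 1) fun i hi =>
    single_apply_of_ne (by omega) _)
  simpa using h

instance countable_Hperp : Countable (Hperp p) :=
  Set.Countable.mono Hperp_subset_tail (countable_tail 0)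

theorem add_mem_Hperp {a b : VilenkinGroup p} (ha : a ∈ Hperp p) (hb : b ∈ Hperp p) :
    a + b ∈ Hperp p := by
  intro x hx
  rw [chi_add_right, ha x hx, hb x hx, one_mul]

end Pairing

/-! ### Haar measure of the subgroups `U l`, periodic and character integrals -/

section Haar

variable {p : ℕ} [NeZero p]

theorem haar_U_zero : haar p (U p 0 : Set (VilenkinGroup p)) = 1 :=
  Measure.addHaarMeasure_self (K₀ := unitCompact p)

theorem haar_U_lt_top (l : ℤ) : haar p (U p l : Set (VilenkinGroup p)) < ∞ :=
  (isCompact_U l).measure_lt_top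

theorem haar_U_ne_zero (l : ℤ) : haar p (U p l : Set (VilenkinGroup p)) ≠ 0 :=
  ((isOpen_U l).measure_pos _ ⟨0, (U p l).zero_mem⟩).ne'

instance isFiniteMeasure_haar_restrict_U (l : ℤ) :
    IsFiniteMeasure ((haar p).restrict (U p l : Set (VilenkinGroup p))) :=
  ⟨by rw [Measure.restrict_apply_univ]; exact haar_U_lt_top l⟩

/-- The coordinate at l + 1 splits `U p l` into p translates of `U p (l + 1)`. -/
theorem haar_U_succ (l : ℤ) : haar p (U p l : Set (VilenkinGroup p)) =
    p * haar p (U p (l + 1) : Set (VilenkinGroup p)) := by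
  have h : (U p l : Set (VilenkinGroup p)) = ⋃ a : ZMod p,
      (fun x => x + -single (l + 1) a) ⁻¹' (U p (l + 1) : Set (VilenkinGroup p)) := by
    ext x
    simp only [Set.mem_iUnion, Set.mem_preimage, SetLike.mem_coe]
    constructor
    · intro hx
      refine ⟨x (l + 1), fun j hj => ?_⟩
      rw [add_apply, neg_apply]
      rcases eq_or_ne j (l + 1) with rfl | hne
      · rw [single_apply_self, add_neg_cancel]
      · rw [single_apply_of_ne hne, hx j (by omega), neg_zero, add_zero]
    · rintro ⟨a, ha⟩ j hj
      have := ha j (by omega)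
      rwa [add_apply, neg_apply, single_apply_of_ne (by omega), neg_zero, add_zero] at this
  rw [h, measure_iUnion]
  · simp only [measure_preimage_add_right, tsum_fintype, Finset.sum_const, Finset.card_univ,
      ZMod.card, nsmul_eq_mul]
  · intro a b hab
    refine Set.disjoint_left.2 fun x ha hb => hab ?_
    have ha := ha (l + 1) le_rfl
    have hb := hb (l + 1) le_rfl
    rw [add_apply, neg_apply, single_apply_self, ← sub_eq_add_neg, sub_eq_zero] at ha hb
    exact ha.symm.trans hb
  · intro a
    exact (measurableSet_U (l + 1)).preimage (measurable_add_const _)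

theorem haar_U_mul_haar_U_neg (n : ℕ) : haar p (U p (n : ℤ) : Set (VilenkinGroup p)) *
    haar p (U p (-(n : ℤ)) : Set (VilenkinGroup p)) = 1 := by
  induction n with
  | zero => simp [haar_U_zero]
  | succ n ih =>
    rw [haar_U_succ (-((n + 1 : ℕ) : ℤ)), ← mul_assoc, mul_comm _ (p : ℝ≥0∞), ← ih,
      haar_U_succ (n : ℤ)]
    congr 3
    push_cast
    ring_nf

/-- The integral of a function on the group that is periodic with respect to `U l`. -/
theorem lintegral_of_periodic {g : VilenkinGroup p → ℝ≥0∞} (l : ℤ)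
    (hg : ∀ x, ∀ u ∈ U p l, g (x + u) = g x) :
    ∫⁻ x, g x ∂haar p = ∑' t : tail p l, g t * haar p (U p l : Set (VilenkinGroup p)) := by
  -- `tail p l` is a countable system of representatives of the cosets of `U p l`.
  have hU : (⋃ t : tail p l, (fun x => x + -(t : VilenkinGroup p)) ⁻¹'
      (U p l : Set (VilenkinGroup p))) = Set.univ := by
    refine Set.eq_univ_of_forall fun x => Set.mem_iUnion.2
      ⟨⟨_, sub_truncate_mem_tail l x⟩, ?_⟩
    rw [Set.mem_preimage, show x + -(x - truncate l x) = truncate l x by abel]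
    exact truncate_mem_U l x
  have hm (t : tail p l) : MeasurableSet ((fun x => x + -(t : VilenkinGroup p)) ⁻¹'
      (U p l : Set (VilenkinGroup p))) :=
    (measurableSet_U l).preimage (measurable_add_const _)
  rw [← setLIntegral_univ, ← hU, lintegral_iUnion hm]
  · refine tsum_congr fun t => ?_
    rw [setLIntegral_congr_fun (g := fun _ => g t) (hm t), setLIntegral_const,
      measure_preimage_add_right]
    intro x hx
    have := hg t _ hx
    rwa [add_add_neg_cancel'_right] at this
  · intro s t hst
    refine Set.disjoint_left.2 fun x hs ht => hst (Subtype.ext (eq_of_sub_mem_U s.2 t.2 ?_))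
    have := (U p l).sub_mem ht hs
    rwa [show x + -(t : VilenkinGroup p) - (x + -(s : VilenkinGroup p)) = s - t by abel] at this

/-- Shifting by an element y of `U p l` with χ(y, ω) ≠ 1 multiplies the integral by χ(y, ω). The
entry of y sits at 1 - k, the index paired with k, and 1 - k > l. -/
theorem setIntegral_chi_eq_zero {l k : ℤ} (hk : k ≤ -l) {ω : VilenkinGroup p} (hω : ω k ≠ 0) :
    ∫ x in (U p l : Set (VilenkinGroup p)), chi x ω ∂haar p = 0 := by
  set y : VilenkinGroup p := single (1 - k) 1 with hy
  have hyU : y ∈ U p l := fun j hj => single_apply_of_ne (by omega) _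
  have hne : chi y ω ≠ 1 := by
    rw [hy, Ne, chi_single_eq_one_iff]
    simpa using hω
  have h : ∫ x in (U p l : Set (VilenkinGroup p)), chi x ω ∂haar p =
      (∫ x in (U p l : Set (VilenkinGroup p)), chi x ω ∂haar p) * chi y ω := by
    rw [← integral_mul_const]
    simp only [← integral_indicator (measurableSet_U l)]
    rw [← integral_add_right_eq_self _ y]
    refine integral_congr_ae (Eventually.of_forall fun x => ?_)
    have hmem : x + y ∈ (U p l : Set (VilenkinGroup p)) ↔ x ∈ (U p l : Set (VilenkinGroup p)) :=
      (U p l).add_mem_cancel_right hyU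
    beta_reduce
    by_cases hx : x ∈ (U p l : Set (VilenkinGroup p))
    · rw [Set.indicator_of_mem hx, Set.indicator_of_mem (hmem.2 hx), chi_add_left]
    · rw [Set.indicator_of_notMem hx, Set.indicator_of_notMem (mt hmem.1 hx)]
  by_contra h0
  exact hne (mul_left_cancel₀ h0 (by rw [mul_one]; exact h.symm))

end Haar

/-! ### Existence and boundedness of the L² Fourier transform -/

section Plancherel

variable {p : ℕ} [NeZero p]

theorem memLp_chi (l : ℤ) (ω : VilenkinGroup p) :
    MemLp (fun x => chi x ω) 2 ((haar p).restrict (U p l : Set (VilenkinGroup p))) :=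
  MemLp.of_bound (continuous_chi_left ω).aestronglyMeasurable 1
    (Eventually.of_forall fun x => (norm_chi x ω).le)

theorem integrableOn_mul_conj_chi (f : L2 p) (l : ℤ) (ω : VilenkinGroup p) :
    IntegrableOn (fun x => f x * starRingEnd ℂ (chi x ω)) (U p l) (haar p) := by
  have h := (memLp_chi l (-ω)).integrable_mul ((Lp.memLp f).restrict (U p l))
  refine h.congr (Eventually.of_forall fun x => ?_)
  simp only [Pi.mul_apply, chi_neg_right, mul_comm]

theorem truncatedFourier_add (f g : L2 p) (n : ℕ) (ω : VilenkinDual p) :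
    truncatedFourier (f + g) n ω = truncatedFourier f n ω + truncatedFourier g n ω := by
  unfold truncatedFourier
  rw [← integral_add (integrableOn_mul_conj_chi f _ ω) (integrableOn_mul_conj_chi g _ ω)]
  refine integral_congr_ae (ae_restrict_of_ae ?_)
  filter_upwards [Lp.coeFn_add f g] with x hx
  rw [hx, Pi.add_apply, add_mul]

theorem truncatedFourier_smul (c : ℂ) (f : L2 p) (n : ℕ) (ω : VilenkinDual p) :
    truncatedFourier (c • f) n ω = c * truncatedFourier f n ω := by
  unfold truncatedFourier
  rw [← integral_const_mul]
  refine integral_congr_ae (ae_restrict_of_ae ?_)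
  filter_upwards [Lp.coeFn_smul c f] with x hx
  rw [hx, Pi.smul_apply, smul_eq_mul, mul_assoc]

theorem truncatedFourier_add_of_mem_U (f : L2 p) (n : ℕ) (ω : VilenkinDual p)
    {u : VilenkinDual p} (hu : u ∈ U p (n : ℤ)) :
    truncatedFourier f n (ω + u) = truncatedFourier f n ω := by
  unfold truncatedFourier
  refine setIntegral_congr_fun (measurableSet_U _) fun x hx => ?_
  simp only [chi_add_right, chi_eq_one hx (show u ∈ U p (-(-(n : ℤ))) by rwa [neg_neg]), mul_one]

theorem continuous_truncatedFourier (f : L2 p) (n : ℕ) : Continuous (truncatedFourier f n) :=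
  continuous_of_periodic n fun ω _ hu => truncatedFourier_add_of_mem_U f n ω hu

/-- The characters of `U (-n)` indexed by `tail n`, normalised in `L²`. -/
noncomputable def normalizedCharacter (n : ℕ) (t : tail p (n : ℤ)) :
    Lp ℂ 2 ((haar p).restrict (U p (-(n : ℤ)) : Set (VilenkinGroup p))) :=
  (((√((haar p).real (U p (-(n : ℤ)))))⁻¹ : ℝ) : ℂ) • (memLp_chi (-(n : ℤ)) t.1).toLp _

theorem haar_real_U_pos (l : ℤ) : 0 < (haar p).real (U p l : Set (VilenkinGroup p)) :=
  ENNReal.toReal_pos (haar_U_ne_zero l) (haar_U_lt_top l).ne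

theorem inner_toLp_chi (n : ℕ) (s t : VilenkinGroup p) :
    inner ℂ ((memLp_chi (-(n : ℤ)) s).toLp _) ((memLp_chi (-(n : ℤ)) t).toLp _) =
      ∫ x in (U p (-(n : ℤ)) : Set (VilenkinGroup p)), chi x (t - s) ∂haar p := by
  rw [L2.inner_def]
  refine integral_congr_ae ?_
  filter_upwards [(memLp_chi (-(n : ℤ)) s).coeFn_toLp, (memLp_chi (-(n : ℤ)) t).coeFn_toLp]
    with x hs ht
  rw [hs, ht, RCLike.inner_apply, sub_eq_add_neg, chi_add_right, chi_neg_right]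

theorem orthonormal_normalizedCharacter (n : ℕ) :
    Orthonormal ℂ (normalizedCharacter (p := p) n) := by
  classical
  rw [orthonormal_iff_ite]
  intro s t
  unfold normalizedCharacter
  rw [inner_smul_left, inner_smul_right, inner_toLp_chi, Complex.conj_ofReal]
  have hc := haar_real_U_pos (p := p) (-(n : ℤ))
  split_ifs with h
  · subst h
    have : ∀ x : VilenkinGroup p, chi x (s.1 - s.1) = 1 := fun x => by
      rw [sub_self]
      obtain ⟨l, hl⟩ := exists_mem_U x
      exact chi_eq_one hl (zero_mem _)
    simp only [this, setIntegral_const, Complex.real_smul, mul_one]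
    norm_cast
    rw [← mul_assoc, ← mul_inv, Real.mul_self_sqrt hc.le, inv_mul_cancel₀ hc.ne']
  -- Distinct elements of `tail p n` lie in different cosets of `U p n`, hence differ at an index k
  -- ≤ n.
  · have hne : ∃ k : ℤ, k ≤ n ∧ (t.1 - s.1) k ≠ 0 := by
      by_contra! h0
      exact h (Subtype.ext (eq_of_sub_mem_U t.2 s.2 h0).symm)
    obtain ⟨k, hk, hk0⟩ := hne
    rw [setIntegral_chi_eq_zero (by omega) hk0, mul_zero, mul_zero]

theorem inner_normalizedCharacter (n : ℕ) (t : tail p (n : ℤ)) (f : L2 p) :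
    inner ℂ (normalizedCharacter n t) (((Lp.memLp f).restrict (U p (-(n : ℤ)))).toLp f) =
      (((√((haar p).real (U p (-(n : ℤ)))))⁻¹ : ℝ) : ℂ) * truncatedFourier f n t := by
  unfold normalizedCharacter
  rw [inner_smul_left, Complex.conj_ofReal, L2.inner_def]
  congr 1
  refine integral_congr_ae ?_
  filter_upwards [(memLp_chi (-(n : ℤ)) t.1).coeFn_toLp,
    ((Lp.memLp f).restrict (U p (-(n : ℤ)))).coeFn_toLp] with x ht hf
  rw [hf, ht, RCLike.inner_apply]

/-- Bessel's inequality; the factor μ(U_{-n}) undoes the normalization of the characters. -/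
theorem tsum_enorm_sq_truncatedFourier_le (f : L2 p) (n : ℕ) :
    ∑' t : tail p (n : ℤ), ‖truncatedFourier f n t‖ₑ ^ 2 ≤
      haar p (U p (-(n : ℤ)) : Set (VilenkinGroup p)) * ‖f‖ₑ ^ 2 := by
  set c := (haar p).real (U p (-(n : ℤ)) : Set (VilenkinGroup p)) with hc
  have hc0 : 0 < c := haar_real_U_pos _
  set F := ((Lp.memLp f).restrict (U p (-(n : ℤ)))).toLp f with hF
  have hFf : ‖F‖ₑ ≤ ‖f‖ₑ := by
    rw [hF, Lp.enorm_toLp, Lp.enorm_def]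
    exact eLpNorm_mono_measure _ Measure.restrict_le_self
  have hterm (t : tail p (n : ℤ)) : ‖truncatedFourier f n t‖ₑ ^ 2 =
      ENNReal.ofReal c * ENNReal.ofReal (‖inner ℂ (normalizedCharacter n t) F‖ ^ 2) := by
    rw [← ENNReal.ofReal_mul hc0.le, inner_normalizedCharacter, norm_mul, mul_pow,
      Complex.norm_real, norm_inv, inv_pow, Real.norm_eq_abs, sq_abs, Real.sq_sqrt hc0.le,
      mul_inv_cancel_left₀ hc0.ne', ENNReal.ofReal_pow (norm_nonneg _), ofReal_norm]
  have hbessel := (orthonormal_normalizedCharacter (p := p) n).tsum_inner_products_le F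
  have hsum := (orthonormal_normalizedCharacter (p := p) n).inner_products_summable F
  calc ∑' t : tail p (n : ℤ), ‖truncatedFourier f n t‖ₑ ^ 2
      = ENNReal.ofReal c *
        ENNReal.ofReal (∑' t, ‖inner ℂ (normalizedCharacter n t) F‖ ^ 2) := by
        rw [ENNReal.ofReal_tsum_of_nonneg (fun _ => sq_nonneg _) hsum, ← ENNReal.tsum_mul_left]
        exact tsum_congr hterm
    _ ≤ ENNReal.ofReal c * ENNReal.ofReal (‖F‖ ^ 2) := by gcongr
    _ ≤ _ := by
        rw [hc, ofReal_measureReal (haar_U_lt_top _).ne, ENNReal.ofReal_pow (norm_nonneg _),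
          ofReal_norm]
        gcongr

theorem eLpNorm_two_sq {α E : Type*} [MeasurableSpace α] [NormedAddCommGroup E] (f : α → E)
    (μ : Measure α) : eLpNorm f 2 μ ^ 2 = ∫⁻ x, ‖f x‖ₑ ^ 2 ∂μ := by
  rw [eLpNorm_eq_lintegral_rpow_enorm_toReal (by norm_num) (by norm_num), ← ENNReal.rpow_natCast,
    ← ENNReal.rpow_mul]
  norm_num

theorem eLpNorm_truncatedFourier_le (f : L2 p) (n : ℕ) :
    eLpNorm (truncatedFourier f n) 2 (haar p) ≤ ‖f‖ₑ := by
  rw [← ENNReal.pow_le_pow_left_iff (n := 2) two_ne_zero, eLpNorm_two_sq,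
    lintegral_of_periodic (n : ℤ) fun x u hu => by rw [truncatedFourier_add_of_mem_U f n x hu],
    ENNReal.tsum_mul_right]
  calc _ ≤ haar p (U p (-(n : ℤ)) : Set (VilenkinGroup p)) * ‖f‖ₑ ^ 2 *
        haar p (U p (n : ℤ) : Set (VilenkinGroup p)) := by
        gcongr
        exact tsum_enorm_sq_truncatedFourier_le f n
    _ = ‖f‖ₑ ^ 2 := by
        rw [mul_right_comm, mul_comm (haar p _), haar_U_mul_haar_U_neg, one_mul]

theorem memLp_truncatedFourier (f : L2 p) (n : ℕ) : MemLp (truncatedFourier f n) 2 (haar p) :=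
  ⟨(continuous_truncatedFourier f n).aestronglyMeasurable,
    (eLpNorm_truncatedFourier_le f n).trans_lt enorm_lt_top⟩

/-- The Fourier integral over `U (-n)` as a contraction of `L²`. -/
noncomputable def truncatedFourierCLM (n : ℕ) : L2 p →L[ℂ] Lp ℂ 2 (haar p) :=
  LinearMap.mkContinuous
    { toFun := fun f => (memLp_truncatedFourier f n).toLp _
      map_add' := fun f g => by
        rw [← MemLp.toLp_add]
        exact MemLp.toLp_congr _ _ (Eventually.of_forall (truncatedFourier_add f g n))
      map_smul' := fun c f => by
        rw [RingHom.id_apply, ← MemLp.toLp_const_smul]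
        exact MemLp.toLp_congr _ _ (Eventually.of_forall (truncatedFourier_smul c f n)) }
    1 fun f => by
      rw [one_mul, ← enorm_le_iff_norm_le]
      exact (Lp.enorm_toLp (memLp_truncatedFourier f n)).trans_le (eLpNorm_truncatedFourier_le f n)

theorem truncatedFourierCLM_apply (n : ℕ) (f : L2 p) :
    truncatedFourierCLM n f = (memLp_truncatedFourier f n).toLp _ := rfl

theorem norm_truncatedFourierCLM_apply_le (n : ℕ) (f : L2 p) :
    ‖truncatedFourierCLM n f‖ ≤ ‖f‖ := by
  rw [← enorm_le_iff_norm_le, truncatedFourierCLM_apply, Lp.enorm_toLp]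
  exact eLpNorm_truncatedFourier_le f n

theorem isFourierTransform_iff (f : L2 p) (g : Lp ℂ 2 (haar p)) :
    IsFourierTransform f g ↔ Tendsto (fun n => truncatedFourierCLM n f) atTop (𝓝 g) := by
  rw [Lp.tendsto_Lp_iff_tendsto_eLpNorm', IsFourierTransform]
  refine tendsto_congr fun n => eLpNorm_congr_ae ?_
  filter_upwards [(memLp_truncatedFourier f n).coeFn_toLp] with ω hω
  rw [Pi.sub_apply, truncatedFourierCLM_apply, hω]

/-- The restriction of `f` to `U (-n)`, extended by zero. -/
noncomputable def cutoff (n : ℕ) (f : L2 p) : L2 p :=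
  ((Lp.memLp f).indicator (measurableSet_U (-(n : ℤ)))).toLp _

theorem truncatedFourier_cutoff {m n : ℕ} (h : m ≤ n) (f : L2 p) (ω : VilenkinDual p) :
    truncatedFourier (cutoff m f) n ω = truncatedFourier f m ω := by
  have hsub : (U p (-(m : ℤ)) : Set (VilenkinGroup p)) ⊆ U p (-(n : ℤ)) :=
    U_anti (by omega)
  unfold truncatedFourier
  rw [← Set.inter_eq_self_of_subset_right hsub, ← setIntegral_indicator (measurableSet_U _)]
  refine integral_congr_ae (ae_restrict_of_ae ?_)
  filter_upwards [((Lp.memLp f).indicator (measurableSet_U (-(m : ℤ)))).coeFn_toLp] with x hx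
  rw [cutoff, hx]
  simp only [Set.indicator]
  split_ifs <;> simp

theorem tendsto_cutoff (f : L2 p) : Tendsto (fun n => cutoff n f) atTop (𝓝 f) := by
  rw [Lp.tendsto_Lp_iff_tendsto_eLpNorm']
  set S : ℕ → Set (VilenkinGroup p) := fun n => (U p (-(n : ℤ)) : Set (VilenkinGroup p))ᶜ with hS
  have hSm (n : ℕ) : MeasurableSet (S n) := (measurableSet_U _).compl
  have hnorm (n : ℕ) : eLpNorm (cutoff n f - f : VilenkinGroup p → ℂ) 2 (haar p) ^ 2 =
      ((haar p).withDensity fun x => ‖f x‖ₑ ^ 2) (S n) := by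
    rw [eLpNorm_two_sq, withDensity_apply _ (hSm n), ← lintegral_indicator (hSm n)]
    refine lintegral_congr_ae ?_
    filter_upwards [((Lp.memLp f).indicator (measurableSet_U (-(n : ℤ)))).coeFn_toLp] with x hx
    rw [Pi.sub_apply, cutoff, hx]
    by_cases hxU : x ∈ (U p (-(n : ℤ)) : Set (VilenkinGroup p)) <;> simp [hS, hxU]
  have hlim : Tendsto (fun n => ((haar p).withDensity fun x => ‖f x‖ₑ ^ 2) (S n)) atTop (𝓝 0) := by
    -- Continuity from above, along the decreasing complements of U_{-n}, needs one set of finite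
    -- mass.
    have hfin : ((haar p).withDensity fun x => ‖f x‖ₑ ^ 2) (S 0) ≠ ∞ := by
      rw [← hnorm, ← eLpNorm_congr_ae (Lp.coeFn_sub _ _)]
      exact ENNReal.pow_ne_top (Lp.eLpNorm_ne_top _)
    have h := tendsto_measure_iInter_atTop
      (μ := (haar p).withDensity fun x => ‖f x‖ₑ ^ 2) (fun n => (hSm n).nullMeasurableSet)
      (fun m n hmn => Set.compl_subset_compl.2 (U_anti (by omega))) ⟨0, hfin⟩
    rwa [Set.iInter_eq_empty_iff.2 fun x => ?_, measure_empty] at h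
    obtain ⟨n, hn⟩ := exists_mem_U_neg_nat x
    exact ⟨n, fun hx => hx (hn n le_rfl)⟩
  simp only [← hnorm] at hlim
  have hsqrt (a : ℝ≥0∞) : (a ^ 2) ^ (1 / 2 : ℝ) = a := by
    rw [← ENNReal.rpow_natCast, ← ENNReal.rpow_mul]
    norm_num
  have := hlim.ennrpow_const (1 / 2)
  rwa [ENNReal.zero_rpow_of_pos (by norm_num), funext fun n => hsqrt _] at this

/-- For n ≥ m the operator at level n sends the cutoff of f at m to the level-m transform of f. By
contraction, the transforms at levels m and n differ by at most the distance from f to that cutoff.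
-/
theorem exists_isFourierTransform (f : L2 p) : ∃ g, IsFourierTransform f g := by
  simp only [isFourierTransform_iff]
  refine cauchySeq_tendsto_of_complete ?_
  rw [Metric.cauchySeq_iff']
  intro ε hε
  obtain ⟨m, hm⟩ := Metric.tendsto_atTop.1 (tendsto_cutoff f) ε hε
  refine ⟨m, fun n hn => ?_⟩
  have h : truncatedFourierCLM m f = truncatedFourierCLM n (cutoff m f) :=
    MemLp.toLp_congr (memLp_truncatedFourier _ _) (memLp_truncatedFourier _ _)
      (Eventually.of_forall fun ω => (truncatedFourier_cutoff hn f ω).symm)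
  rw [h, dist_eq_norm, ← map_sub]
  refine (norm_truncatedFourierCLM_apply_le _ _).trans_lt ?_
  rw [← dist_eq_norm, dist_comm]
  exact hm m le_rfl

theorem tendsto_truncatedFourierCLM (f : L2 p) :
    Tendsto (fun n => truncatedFourierCLM n f) atTop (𝓝 (fourier f)) := by
  have h := exists_isFourierTransform f
  rw [← isFourierTransform_iff, fourier, dif_pos h]
  exact h.choose_spec

/-- The Fourier transform as a bounded operator of `L²`. -/
noncomputable def fourierCLM : L2 p →L[ℂ] Lp ℂ 2 (haar p) :=
  LinearMap.mkContinuous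
    { toFun := fourier
      map_add' := fun f g => tendsto_nhds_unique (tendsto_truncatedFourierCLM (f + g)) (by
        simpa only [map_add] using
          (tendsto_truncatedFourierCLM f).add (tendsto_truncatedFourierCLM g))
      map_smul' := fun c f => tendsto_nhds_unique (tendsto_truncatedFourierCLM (c • f)) (by
        simpa only [map_smul, RingHom.id_apply] using (tendsto_truncatedFourierCLM f).const_smul c) }
    1 fun f => by
      rw [one_mul]
      exact le_of_tendsto (tendsto_truncatedFourierCLM f).norm
        (Eventually.of_forall fun n => norm_truncatedFourierCLM_apply_le n f)

end Plancherel

/-! ### Translations become modulations -/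

section Translation

variable {p : ℕ} [NeZero p]

/-- As h lies in the subgroup U_{-n}, the domain of integration is invariant under the substitution,
so no error term appears. -/
theorem truncatedFourier_translate {n : ℕ} {h : VilenkinGroup p} (hh : h ∈ U p (-(n : ℤ)))
    (f : L2 p) (ω : VilenkinDual p) :
    truncatedFourier (translate h f) n ω =
      starRingEnd ℂ (chi h ω) * truncatedFourier f n ω := by
  unfold truncatedFourier
  rw [← integral_const_mul]
  simp only [← integral_indicator (measurableSet_U (-(n : ℤ)))]
  symm
  rw [← integral_sub_right_eq_self _ h]
  refine integral_congr_ae ?_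
  filter_upwards [Lp.coeFn_compMeasurePreserving f (measurePreserving_sub_right (haar p) h)]
    with x hx
  have hmem : x - h ∈ (U p (-(n : ℤ)) : Set (VilenkinGroup p)) ↔
      x ∈ (U p (-(n : ℤ)) : Set (VilenkinGroup p)) := by
    rw [sub_eq_add_neg]
    exact (U p (-(n : ℤ))).add_mem_cancel_right (neg_mem hh)
  have hchi : chi x ω = chi h ω * chi (x - h) ω := by
    rw [← chi_add_left, add_sub_cancel]
  by_cases hxU : x ∈ (U p (-(n : ℤ)) : Set (VilenkinGroup p))
  · rw [Set.indicator_of_mem hxU, Set.indicator_of_mem (hmem.2 hxU), translate, hx, hchi, map_mul,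
      Function.comp_apply]
    ring
  · rw [Set.indicator_of_notMem hxU, Set.indicator_of_notMem (mt hmem.1 hxU)]

theorem memLp_conj_chi_mul (h : VilenkinGroup p) (g : Lp ℂ 2 (haar p : Measure (VilenkinDual p))) :
    MemLp (fun ω => starRingEnd ℂ (chi h ω) * g ω) 2 (haar p) := by
  refine (Lp.memLp g).of_le ?_ (Eventually.of_forall fun ω => ?_)
  · exact (Complex.continuous_conj.comp (continuous_chi_right h)).aestronglyMeasurable.mul
      (Lp.aestronglyMeasurable g)
  · rw [norm_mul, RCLike.norm_conj, norm_chi, one_mul]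

theorem fourier_translate (h : VilenkinGroup p) (f : L2 p) :
    fourier (translate h f) =ᵐ[haar p] fun ω => starRingEnd ℂ (chi h ω) * fourier f ω := by
  have hlim : IsFourierTransform (translate h f) ((memLp_conj_chi_mul h (fourier f)).toLp _) := by
    have hf := (isFourierTransform_iff f _).2 (tendsto_truncatedFourierCLM f)
    refine hf.congr' ?_
    obtain ⟨n, hn⟩ := exists_mem_U_neg_nat h
    filter_upwards [eventually_ge_atTop n] with m hm
    refine eLpNorm_congr_norm_ae ?_
    filter_upwards [(memLp_conj_chi_mul h (fourier f)).coeFn_toLp] with ω hω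
    rw [hω, truncatedFourier_translate (hn m hm), ← mul_sub, norm_mul, RCLike.norm_conj, norm_chi,
      one_mul]
  rw [tendsto_nhds_unique (tendsto_truncatedFourierCLM _) ((isFourierTransform_iff _ _).1 hlim)]
  exact MemLp.coeFn_toLp _

/-- If the Fourier transform of `φ` vanishes on a measurable set, then so do the Fourier
transforms of all elements of the shift-invariant space generated by `φ`. -/
theorem fourier_ae_eq_zero_of_mem_principalShiftInvariant {φ ψ : L2 p}
    (hψ : ψ ∈ principalShiftInvariant φ) {N : Set (VilenkinDual p)} (hN : MeasurableSet N)
    (hφ : ∀ ω ∈ N, fourier φ ω = 0) : ∀ᵐ ω ∂haar p, ω ∈ N → fourier ψ ω = 0 := by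
  set T : L2 p →L[ℂ] Lp ℂ 2 ((haar p).restrict N) :=
    (LpToLpRestrictCLM (VilenkinDual p) ℂ ℂ (haar p) 2 N).comp fourierCLM with hT
  have hTiff (f : L2 p) : T f = 0 ↔ ∀ᵐ ω ∂haar p, ω ∈ N → fourier f ω = 0 := by
    rw [← ae_restrict_iff' hN, Lp.eq_zero_iff_ae_eq_zero]
    have h : T f =ᵐ[(haar p).restrict N] fourier f := LpToLpRestrictCLM_coeFn ℂ N (fourierCLM f)
    exact ⟨fun h0 => h.symm.trans h0, fun h0 => h.trans h0⟩
  rw [← hTiff]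
  -- The kernel of `T` is a closed subspace, so only the translates of φ need checking.
  suffices principalShiftInvariant φ ≤ T.ker from this hψ
  refine Submodule.topologicalClosure_minimal _ (Submodule.span_le.2 ?_) T.isClosed_ker
  rintro _ ⟨h, rfl⟩
  refine (hTiff _).2 ?_
  filter_upwards [fourier_translate (h : VilenkinGroup p) φ] with ω hω hωN
  rw [hω, hφ ω hωN, mul_zero]

end Translation

/-! ### Periodizations and their supports -/

section Periodization

variable {p : ℕ} [NeZero p]

theorem measurable_periodization (f : L2 p) : Measurable (periodization f) := by
  refine Measurable.tsum fun h => ?_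
  exact (((Lp.stronglyMeasurable (fourier f)).measurable.comp
    (measurable_add_const _)).enorm).pow_const 2

theorem periodization_eq_zero_iff {f : L2 p} {ω : VilenkinDual p} :
    periodization f ω = 0 ↔ ∀ h ∈ Hperp p, fourier f (ω + h) = 0 := by
  simp [periodization, ENNReal.tsum_eq_zero]

theorem zero_mem_Hperp : (0 : VilenkinDual p) ∈ Hperp p := by
  intro x _
  obtain ⟨l, hl⟩ := exists_mem_U x
  exact chi_eq_one hl (zero_mem _)

theorem periodization_add_eq_zero {f : L2 p} {ω h : VilenkinDual p} (hω : periodization f ω = 0)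
    (hh : h ∈ Hperp p) : periodization f (ω + h) = 0 := by
  refine periodization_eq_zero_iff.2 fun k hk => ?_
  rw [add_assoc]
  exact periodization_eq_zero_iff.1 hω _ (add_mem_Hperp hh hk)

theorem ae_add_right {P : VilenkinGroup p → Prop} (hP : ∀ᵐ x ∂haar p, P x) (h : VilenkinGroup p) :
    ∀ᵐ x ∂haar p, P (x + h) :=
  (measurePreserving_add_right (haar p) h).quasiMeasurePreserving.ae hP

theorem periodizationSupport_ae_le {φ ψ : L2 p} (hψ : ψ ∈ principalShiftInvariant φ) :
    periodizationSupport ψ ≤ᵐ[haar p] periodizationSupport φ := by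
  have h0 : ∀ᵐ ω ∂haar p, periodization φ ω = 0 → fourier ψ ω = 0 :=
    fourier_ae_eq_zero_of_mem_principalShiftInvariant hψ
      (measurable_periodization φ (measurableSet_singleton 0)) fun ω hω => by
        rw [← add_zero ω]
        exact periodization_eq_zero_iff.1 hω 0 zero_mem_Hperp
  -- Countability of H^⊥ gives one null set that serves all h.
  have h1 : ∀ᵐ ω ∂haar p, ∀ h : Hperp p, periodization φ (ω + (h : VilenkinDual p)) = 0 →
      fourier ψ (ω + (h : VilenkinDual p)) = 0 :=
    ae_all_iff.2 fun h => ae_add_right h0 h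
  filter_upwards [h1] with ω hω
  exact fun hωψ hωφ => hωψ (periodization_eq_zero_iff.2 fun h hh =>
    hω ⟨h, hh⟩ (periodization_add_eq_zero hωφ hh))

theorem translate_zero (f : L2 p) : translate 0 f = f := by
  refine Lp.ext ((Lp.coeFn_compMeasurePreserving f _).trans (Eventually.of_forall fun x => ?_))
  simp

theorem self_mem_principalShiftInvariant (f : L2 p) : f ∈ principalShiftInvariant f :=
  Submodule.le_topologicalClosure _ (Submodule.subset_span ⟨0, translate_zero f⟩)

end Periodization

end VilenkinGroup

theorem mainTheorem7 (p : ℕ) [NeZero p] (hp : 2 ≤ p) (φ ψ : VilenkinGroup.L2 p)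
    (h : VilenkinGroup.principalShiftInvariant φ = VilenkinGroup.principalShiftInvariant ψ) :
    VilenkinGroup.periodizationSupport φ =ᵐ[VilenkinGroup.haar p]
      VilenkinGroup.periodizationSupport ψ :=
  (VilenkinGroup.periodizationSupport_ae_le
      (h ▸ VilenkinGroup.self_mem_principalShiftInvariant φ)).antisymm
    (VilenkinGroup.periodizationSupport_ae_le
      (h ▸ VilenkinGroup.self_mem_principalShiftInvariant ψ))
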